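/- **Setting.** Let $d\ge 1$ and let $\mathbb B_d$ be the open Euclidean unit ball of $\mathbb C^d$. A *unitarily invariant kernel* is a function $k(z,w)=\sum_{n\ge 0}a_n^{(k)}\langle z,w\rangle^n$ on $\mathbb B_d\times\mathbb B_d$ without zeros, where $a_0^{(k)}=1$ and all $a_n^{(k)}>0$. Write $1-1/\sum_{n\ge0} a_n^{(k)}t^n=\sum_{n\ge1}b_n^{(k)}t^n$, and for a multi-index $\alpha\in\mathbb Z_+^d$ put $a_\alpha^{(k)}=a_{|\alpha|}^{(k)}\frac{|\alpha|!}{\alpha!}$, $b_\alpha^{(k)}=b_{|\alpha|}^{(k)}\frac{|\alpha|!}{\alpha!}$. For a complex Hilbert space $E$, $H_k\otimes E$ is the Hilbert space of functions $f(z)=\sum_\alpha c_\alpha z^\alpha$ on $\mathbb B_d$, $c_\alpha\in E$, with $\|f\|^2=\sum_\alpha\|c_\alpha\|^2/a_\alpha^{(k)}<\infty$. For two such kernels $s,k$, a function $\theta:\mathbb B_d\to\mathcal B(E,F)$ is a *multiplier* from $H_s\otimes E$ to $H_k\otimes F$ if $\theta f\in H_k\otimes F$ for all $f\in H_s\otimes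 E$; then $M_\theta f=\theta f$ is a bounded operator, and $\theta$ is called *partially isometric* if $M_\theta$ is a partial isometry. A commuting tuple $T=(T_1,\dots,T_d)$ of bounded operators on a complex Hilbert space $H$ is a *$1/k$-contraction* if $\sum_{\alpha\ne0}b^{(k)}_\alpha T^\alpha (T^\alpha)^*$ (summed by increasing degree) converges in the strong operator topology to a contraction; then $\Delta_T$ is the positive square root of $I-\sum_{\alpha\neq 0} b^{(k)}_\alpha T^\alpha(T^\alpha)^*$. It is *pure* if $\sum_\alpha a^{(k)}_\alpha T^\alpha\Delta_T^2(T^\alpha)^*$ converges strongly to $I$; then $$V_T:H\to H_k\otimes\overline{\mathrm{Ran}}\,\Delta_T,\qquad V_Th=\sum_\alpha a^{(k)}_\alpha z^\alpha\otimes\Delta_T(T^\alpha)^*h$$ is an isometry. The kernel $k$ is *admissible* if the multiplications $M_{z_i}$ by the coordinate functions are bounded on $H_k$ and form a $1/k$-contraction. A *unitarily invariant complete Nevanlinna–Pick (CNP) kernel* is a unitarily invariant kernel $s$ such that $H_s$ is irreducible ($s$ has no zeros, and $s_v,s_w$ are linearly independent for $v\ne w$, where $s_w=s(\cdot,w)$)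 and, for all $m,n\ge1$, all finite families of points $\lambda_i\in\mathbb B_d$ and of $m\times n$ matrices $W_i$ for which the block matrix $[(I-W_iW_j^*)s(\lambda_i,\lambda_j)]_{i,j}$ is positive semidefinite, there is a multiplier $\varphi$ from $H_s\otimes\mathbb C^n$ to $H_s\otimes\mathbb C^m$ with $\|M_\varphi\|\le1$ and $\varphi(\lambda_i)=W_i$ for all $i$. **Theorem.** Let $k$ be an admissible kernel with two factorizations $k=s_1g_1=s_2g_2$, where $s_1,s_2$ are unitarily invariant CNP kernels and $g_1,g_2$ are positive semidefinite kernels on $\mathbb B_d$. Let $T$ be a pure $1/k$-contraction on a Hilbert space $H$ that is non-trivial, meaning that for no complex Hilbert space $E$ (of any dimension, including $0$) is $T$ unitarily equivalent to the tuple $(M_{z_1}\otimes I_E,\dots,M_{z_d}\otimes I_E)$ on $H_k\otimes E$. Let $E_1,E_2$ be complex Hilbert spaces and, for $i=1,2$, let $\theta_i:\mathbb B_d\to\mathcal B(E_i,\overline{\mathrm{Ran}}\,\Delta_T)$ be a partially isometric multiplier from $H_{s_i}\otimes E_i$ to $H_k\otimes\overline{\mathrm{Ran}}\,\Delta_T$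 with $$I-V_TV_T^*=M_{\theta_i}M_{\theta_i}^*.$$ 1. There is a partial isometry $V_m:H_{s_1}\otimes E_1\to H_{s_2}\otimes E_2$ such that $M_{\theta_1}=M_{\theta_2}V_m$ and $M_{\theta_2}=M_{\theta_1}V_m^*$. 2. There is a partial isometry $V_f:E_1\to E_2$ such that $\theta_1(z)=\theta_2(z)V_f$ and $\theta_2(z)=\theta_1(z)V_f^*$ for all $z\in\mathbb B_d$ if and only if $s_1=s_2$. -/

import Mathlib

open scoped ComplexOrder

noncomputable section

namespace CNPFactor

/-- The Euclidean open unit ball of `ℂ^d`. -/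
abbrev UnitBall (d : ℕ) : Type := Metric.ball (0 : EuclideanSpace ℂ (Fin d)) 1

/-- A (non-vanishing) unitarily invariant kernel on the unit ball, given by its coefficients:
`k(z, w) = ∑ₙ aₙ ⟨z, w⟩ⁿ`, where `aₙ > 0`, `a₀ = 1`. The inner product `⟨z, w⟩`, linear in `z`, is
`inner ℂ w z` in Mathlib. -/
structure UIKernel (d : ℕ) where
  a : ℕ → ℝ
  a_zero : a 0 = 1
  a_pos : ∀ n, 0 < a n
  summable : ∀ z w : UnitBall d,
    Summable fun n : ℕ => (a n : ℂ) * (inner ℂ (w : EuclideanSpace ℂ (Fin d)) z) ^ n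
  nonvanishing : ∀ z w : UnitBall d,
    ∑' n : ℕ, (a n : ℂ) * (inner ℂ (w : EuclideanSpace ℂ (Fin d)) z) ^ n ≠ 0

/-- The function `k(z, w)`. -/
def UIKernel.ker {d : ℕ} (k : UIKernel d) (z w : UnitBall d) : ℂ :=
  ∑' n : ℕ, (k.a n : ℂ) * (inner ℂ (w : EuclideanSpace ℂ (Fin d)) z) ^ n

/-- `a_α = a_{|α|} |α|! / α!`. -/
def UIKernel.aMulti {d : ℕ} (k : UIKernel d) (α : Fin d → ℕ) : ℝ :=
  k.a (∑ i, α i) * Nat.multinomial Finset.univ α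

/-- The coefficients `bₙ`, `n ≥ 1`, of the power series `1 - 1 / ∑ₙ aₙ tⁿ`. -/
def UIKernel.b {d : ℕ} (k : UIKernel d) (n : ℕ) : ℝ :=
  PowerSeries.coeff n (1 - (PowerSeries.mk k.a)⁻¹)

/-- `b_α = b_{|α|} |α|! / α!`. -/
def UIKernel.bMulti {d : ℕ} (k : UIKernel d) (α : Fin d → ℕ) : ℝ :=
  k.b (∑ i, α i) * Nat.multinomial Finset.univ α

/-- The monomial `z^α`. -/
def monom {d : ℕ} (z : EuclideanSpace ℂ (Fin d)) (α : Fin d → ℕ) : ℂ := ∏ i, z i ^ α i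

theorem UIKernel.aMulti_pos {d : ℕ} (k : UIKernel d) (α : Fin d → ℕ) : 0 < k.aMulti α :=
  mul_pos (k.a_pos _) (by exact_mod_cast Nat.multinomial_pos _ _)

theorem sum_degree {d : ℕ} (k : UIKernel d) (z w : EuclideanSpace ℂ (Fin d)) (n : ℕ) :
    ∑ α ∈ Finset.piAntidiag Finset.univ n,
      (k.aMulti α : ℂ) * (monom z α * starRingEnd ℂ (monom w α))
      = (k.a n : ℂ) * (inner ℂ w z) ^ n := by
  have h1 : (inner ℂ w z : ℂ) = ∑ i, z i * starRingEnd ℂ (w i) := by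
    simp [PiLp.inner_apply]
  rw [h1, Finset.sum_pow_eq_sum_piAntidiag, Finset.mul_sum]
  refine Finset.sum_congr rfl fun α hα => ?_
  have h2 : ∑ i, α i = n := by simpa using hα
  simp only [UIKernel.aMulti, h2, monom, map_prod, map_pow, mul_pow, Finset.prod_mul_distrib]
  push_cast
  ring

theorem inner_self_eq_ofReal {d : ℕ} (z : EuclideanSpace ℂ (Fin d)) :
    (inner ℂ z z : ℂ) = ((‖z‖ ^ 2 : ℝ) : ℂ) := by
  rw [inner_self_eq_norm_sq_to_K]
  push_cast
  rfl

theorem sum_degree_norm {d : ℕ} (k : UIKernel d) (z : EuclideanSpace ℂ (Fin d)) (n : ℕ) :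
    ∑ α ∈ Finset.piAntidiag Finset.univ n, k.aMulti α * ‖monom z α‖ ^ 2
      = k.a n * (‖z‖ ^ 2) ^ n := by
  have h := sum_degree k z z n
  rw [inner_self_eq_ofReal] at h
  have : ∀ α, (k.aMulti α : ℂ) * (monom z α * starRingEnd ℂ (monom z α))
      = ((k.aMulti α * ‖monom z α‖ ^ 2 : ℝ) : ℂ) := by
    intro α
    rw [Complex.mul_conj, Complex.normSq_eq_norm_sq]
    push_cast
    rfl
  simp only [this] at h
  exact_mod_cast h

/-- Every finite set of multi-indices lies in the set of multi-indices of degree `< N`, `N` large. -/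
theorem exists_subset_degree {d : ℕ} (s : Finset (Fin d → ℕ)) : ∃ N : ℕ, ∀ M, N ≤ M →
    s ⊆ (Finset.range M).biUnion fun n => Finset.piAntidiag Finset.univ n := by
  refine ⟨s.sup (fun α => ∑ i, α i) + 1, fun M hM α hα => ?_⟩
  have : ∑ i, α i ≤ s.sup (fun α => ∑ i, α i) :=
    Finset.le_sup (f := fun α : Fin d → ℕ => ∑ i, α i) hα
  simp only [Finset.mem_biUnion, Finset.mem_range]
  exact ⟨∑ i, α i, by omega, by simp⟩

theorem sum_biUnion_degree {d : ℕ} {A : Type*} [AddCommMonoid A] (f : (Fin d → ℕ) → A) (N : ℕ) :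
    ∑ α ∈ (Finset.range N).biUnion (fun n => Finset.piAntidiag Finset.univ n), f α
      = ∑ n ∈ Finset.range N, ∑ α ∈ Finset.piAntidiag Finset.univ n, f α := by
  refine Finset.sum_biUnion ?_
  intro m _ n _ hmn
  refine Finset.disjoint_left.mpr fun α h1 h2 => hmn ?_
  have h1' : ∑ i, α i = m := by simpa using h1
  have h2' : ∑ i, α i = n := by simpa using h2
  omega

theorem summable_aMulti {d : ℕ} (k : UIKernel d) (z : UnitBall d) :
    Summable fun α : Fin d → ℕ => k.aMulti α * ‖monom z.1 α‖ ^ 2 := by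
  have hs : Summable fun n : ℕ => k.a n * (‖z.1‖ ^ 2) ^ n := by
    have := k.summable z z
    rw [inner_self_eq_ofReal] at this
    exact_mod_cast this
  refine summable_of_sum_le (c := ∑' n : ℕ, k.a n * (‖z.1‖ ^ 2) ^ n)
    (fun α => mul_nonneg (k.aMulti_pos α).le (by positivity)) fun s => ?_
  obtain ⟨N, hN⟩ := exists_subset_degree s
  refine (Finset.sum_le_sum_of_subset_of_nonneg (hN N le_rfl)
    fun α _ _ => mul_nonneg (k.aMulti_pos α).le (by positivity)).trans ?_
  rw [sum_biUnion_degree]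
  simp only [sum_degree_norm]
  exact hs.sum_le_tsum _ fun n _ => mul_nonneg (k.a_pos n).le (by positivity)

/-- The Hilbert space `H_k(E) = H_k ⊗ E` of all functions `f(z) = ∑_α c_α z^α` on the unit ball,
`c_α ∈ E`, with `‖f‖² = ∑_α ‖c_α‖² / a_α < ∞` (recall that `‖z^α‖² = 1 / a_α`). An element is stored
as the square summable family `x_α = c_α / √a_α` of its coordinates with respect to the orthonormal
monomials `√a_α z^α`; it is made into a function on the ball by the `RKHS` instance below. -/
def Hk {d : ℕ} (_k : UIKernel d) (E : Type*) [NormedAddCommGroup E] [InnerProductSpace ℂ E] :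
    Type _ :=
  lp (fun _ : Fin d → ℕ => E) 2

section Hk

variable {d : ℕ} (k : UIKernel d) (E : Type*) [NormedAddCommGroup E] [InnerProductSpace ℂ E]

instance : NormedAddCommGroup (Hk k E) :=
  inferInstanceAs (NormedAddCommGroup (lp (fun _ : Fin d → ℕ => E) 2))

instance : InnerProductSpace ℂ (Hk k E) :=
  inferInstanceAs (InnerProductSpace ℂ (lp (fun _ : Fin d → ℕ => E) 2))

instance [CompleteSpace E] : CompleteSpace (Hk k E) :=
  inferInstanceAs (CompleteSpace (lp (fun _ : Fin d → ℕ => E) 2))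

variable {k E}

/-- The coordinates `x_α` of an element of `H_k(E)`. -/
def Hk.coord (f : Hk k E) (α : Fin d → ℕ) : E :=
  (show lp (fun _ : Fin d → ℕ => E) 2 from f) α

theorem Hk.ext_coord {f g : Hk k E} (h : ∀ α, f.coord α = g.coord α) : f = g :=
  lp.ext (funext h)

theorem Hk.coord_add (f g : Hk k E) (α : Fin d → ℕ) :
    (f + g).coord α = f.coord α + g.coord α := rfl

theorem Hk.coord_smul (c : ℂ) (f : Hk k E) (α : Fin d → ℕ) :
    (c • f).coord α = c • f.coord α := rfl

theorem Hk.hasSum_norm_sq (f : Hk k E) : HasSum (fun α => ‖f.coord α‖ ^ 2) (‖f‖ ^ 2) := by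
  have := lp.hasSum_norm (p := 2) (by norm_num) (show lp (fun _ : Fin d → ℕ => E) 2 from f)
  simp only [ENNReal.toReal_ofNat, Real.rpow_ofNat] at this
  exact this

/-- The element of `H_k(E)` with given square summable coordinates. -/
def Hk.mk (x : (Fin d → ℕ) → E) (hx : Summable fun α => ‖x α‖ ^ 2) : Hk k E :=
  (show lp (fun _ : Fin d → ℕ => E) 2 from ⟨x, memℓp_gen (by simpa using hx)⟩)

theorem Hk.coord_mk (x : (Fin d → ℕ) → E) (hx : Summable fun α => ‖x α‖ ^ 2) (α : Fin d → ℕ) :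
    (Hk.mk x hx : Hk k E).coord α = x α := rfl

/-- The value at `z` of the function with coordinates `x_α`. -/
def Hk.eval (f : Hk k E) (z : UnitBall d) : E :=
  ∑' α : Fin d → ℕ, ((√(k.aMulti α) : ℂ) * monom z.1 α) • f.coord α

theorem Hk.norm_term (f : Hk k E) (z : UnitBall d) (α : Fin d → ℕ) :
    ‖((√(k.aMulti α) : ℂ) * monom z.1 α) • f.coord α‖
      = (√(k.aMulti α) * ‖monom z.1 α‖) * ‖f.coord α‖ := by
  rw [norm_smul, norm_mul, Complex.norm_real, Real.norm_of_nonneg (Real.sqrt_nonneg _)]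

theorem Hk.bound (f : Hk k E) (z : UnitBall d) :
    (Summable fun α => ‖((√(k.aMulti α) : ℂ) * monom z.1 α) • f.coord α‖) ∧
    ∑' α, ‖((√(k.aMulti α) : ℂ) * monom z.1 α) • f.coord α‖ ≤
      √(∑' α : Fin d → ℕ, k.aMulti α * ‖monom z.1 α‖ ^ 2) * ‖f‖ := by
  have h := Real.summable_and_inner_le_Lp_mul_Lq_tsum_of_nonneg Real.HolderConjugate.two_two
    (f := fun α : Fin d → ℕ => √(k.aMulti α) * ‖monom z.1 α‖) (g := fun α => ‖f.coord α‖)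
    (fun α => by positivity) (fun α => by positivity)
    (by
      refine (summable_aMulti k z).congr fun α => ?_
      rw [Real.rpow_two, mul_pow, Real.sq_sqrt (k.aMulti_pos α).le])
    (by simpa using (Hk.hasSum_norm_sq f).summable)
  simp only [Hk.norm_term]
  refine ⟨h.1, h.2.trans (le_of_eq ?_)⟩
  congr 1
  · rw [Real.sqrt_eq_rpow]
    congr 1
    refine tsum_congr fun α => ?_
    rw [Real.rpow_two, mul_pow, Real.sq_sqrt (k.aMulti_pos α).le]
  · simp only [Real.rpow_two, (Hk.hasSum_norm_sq f).tsum_eq]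
    rw [← Real.sqrt_eq_rpow, Real.sqrt_sq (norm_nonneg _)]

theorem Hk.summable_eval [CompleteSpace E] (f : Hk k E) (z : UnitBall d) :
    Summable fun α => ((√(k.aMulti α) : ℂ) * monom z.1 α) • f.coord α :=
  (Hk.bound f z).1.of_norm

/-- Point evaluation at `z`, as a continuous linear map. -/
def Hk.evalCLM [CompleteSpace E] (z : UnitBall d) : Hk k E →L[ℂ] E :=
  LinearMap.mkContinuous
    { toFun := fun f => f.eval z
      map_add' := fun f g => by
        simp only [Hk.eval, Hk.coord_add, smul_add]
        exact (Hk.summable_eval f z).tsum_add (Hk.summable_eval g z)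
      map_smul' := fun c f => by
        simp only [Hk.eval, Hk.coord_smul, RingHom.id_apply]
        rw [← (Hk.summable_eval f z).tsum_const_smul]
        exact tsum_congr fun α => smul_comm _ _ _ }
    (√(∑' α : Fin d → ℕ, k.aMulti α * ‖monom z.1 α‖ ^ 2))
    fun f => (norm_tsum_le_tsum_norm (Hk.bound f z).1).trans (Hk.bound f z).2

/-- Uniqueness of the coefficients of a power series that vanishes on the ball. -/
theorem coeff_eq_zero_of_vanish {c : (Fin d → ℕ) → ℂ}
    (h : ∀ z : UnitBall d, HasSum (fun α => c α * monom z.1 α) 0) (α : Fin d → ℕ) : c α = 0 := by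
  -- homogeneous parts vanish
  have hom : ∀ (z : UnitBall d) (n : ℕ),
      ∑ α ∈ Finset.piAntidiag Finset.univ n, c α * monom z.1 α = 0 := by
    intro z n
    set p : FormalMultilinearSeries ℂ ℂ ℂ := FormalMultilinearSeries.ofScalars ℂ
      (fun n => ∑ α ∈ Finset.piAntidiag Finset.univ n, c α * monom z.1 α) with hp
    have hps : HasFPowerSeriesAt (fun _ : ℂ => (0 : ℂ)) p 0 := by
      rw [hasFPowerSeriesAt_iff]
      filter_upwards [Metric.ball_mem_nhds (0 : ℂ) one_pos] with t ht
      have ht' : ‖t‖ < 1 := by simpa using ht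
      have hz : ‖z.1‖ < 1 := mem_ball_zero_iff.mp z.2
      have htz : t • z.1 ∈ Metric.ball (0 : EuclideanSpace ℂ (Fin d)) 1 := by
        rw [mem_ball_zero_iff, norm_smul]
        nlinarith [norm_nonneg t, norm_nonneg z.1]
      have h1 := (h ⟨t • z.1, htz⟩).tsum_fiberwise (fun α => ∑ i, α i)
      refine h1.congr_fun ?_
      intro n
      have hset : (fun α : Fin d → ℕ => ∑ i, α i) ⁻¹' {n}
          = ((Finset.piAntidiag Finset.univ n : Finset (Fin d → ℕ)) : Set (Fin d → ℕ)) := by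
        ext α
        simp
      rw [hset, Finset.tsum_subtype' (Finset.piAntidiag Finset.univ n)
        (fun α => c α * monom (t • z.1) α), hp, FormalMultilinearSeries.coeff_ofScalars,
        smul_eq_mul, Finset.mul_sum]
      refine Finset.sum_congr rfl fun α hα => ?_
      have h2 : ∑ i, α i = n := by simpa using hα
      have h3 : monom (t • z.1) α = t ^ n * monom z.1 α := by
        simp only [monom, PiLp.smul_apply, smul_eq_mul, mul_pow, Finset.prod_mul_distrib,
          Finset.prod_pow_eq_pow_sum, h2]
      rw [h3]
      ring
    have h0 := congrArg (fun q => FormalMultilinearSeries.coeff q n) hps.eq_zero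
    rw [hp, FormalMultilinearSeries.coeff_ofScalars] at h0
    exact h0
  -- a polynomial that vanishes on a polydisc is zero
  set n := ∑ i, α i with hn
  set q : MvPolynomial (Fin d) ℂ := ∑ β ∈ Finset.piAntidiag Finset.univ n,
    MvPolynomial.monomial (Finsupp.equivFunOnFinite.symm β) (c β) with hq
  have hr : (0 : ℝ) < 1 / (d + 1) := by positivity
  have hq0 : q = 0 := by
    refine MvPolynomial.funext_set (fun _ : Fin d => Metric.ball (0 : ℂ) (1 / (d + 1)))
      (fun _ => infinite_of_mem_nhds (0 : ℂ) (Metric.ball_mem_nhds _ hr)) fun x hx => ?_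
    have hxz : WithLp.toLp 2 x ∈ Metric.ball (0 : EuclideanSpace ℂ (Fin d)) 1 := by
      rw [mem_ball_zero_iff, EuclideanSpace.norm_eq, Real.sqrt_lt' one_pos]
      have hi : ∀ i, ‖x i‖ ^ 2 ≤ (1 / ((d : ℝ) + 1)) ^ 2 := fun i => by
        have : ‖x i‖ < 1 / ((d : ℝ) + 1) := by simpa using hx i (Set.mem_univ i)
        gcongr
      calc ∑ i, ‖x i‖ ^ 2 ≤ ∑ _i : Fin d, (1 / ((d : ℝ) + 1)) ^ 2 :=
            Finset.sum_le_sum fun i _ => hi i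
        _ = d / (d + 1) ^ 2 := by simp; ring
        _ < 1 ^ 2 := by
            rw [div_lt_iff₀ (by positivity)]
            nlinarith [(Nat.cast_nonneg d : (0 : ℝ) ≤ d)]
    have := hom ⟨WithLp.toLp 2 x, hxz⟩ n
    simp only [monom] at this
    simp only [hq, map_sum, MvPolynomial.eval_monomial, map_zero]
    rw [← this]
    refine Finset.sum_congr rfl fun β _ => ?_
    rw [Finsupp.prod_fintype _ _ (by simp)]
    rfl
  have hc := congrArg (MvPolynomial.coeff (Finsupp.equivFunOnFinite.symm α)) hq0
  simp only [hq, MvPolynomial.coeff_sum, MvPolynomial.coeff_monomial, MvPolynomial.coeff_zero,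
    EmbeddingLike.apply_eq_iff_eq] at hc
  rw [Finset.sum_ite_eq'] at hc
  simpa [hn] using hc

/-- `H_k(E)` is a Hilbert space of `E`-valued functions on the unit ball. -/
instance [CompleteSpace E] : RKHS ℂ (Hk k E) (UnitBall d) E where
  coeCLM := ContinuousLinearMap.pi fun z => Hk.evalCLM z
  coeCLM_injective := by
    refine (injective_iff_map_eq_zero _).mpr fun f hf => Hk.ext_coord fun α => ?_
    change f.coord α = 0
    refine ext_inner_left ℂ fun y => ?_
    rw [inner_zero_right]
    have h := coeff_eq_zero_of_vanish (c := fun α => (√(k.aMulti α) : ℂ) * inner ℂ y (f.coord α))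
      (fun z => by
        have h1 := (Hk.summable_eval f z).hasSum
        have h2 : ∑' α, ((√(k.aMulti α) : ℂ) * monom z.1 α) • f.coord α = 0 := congrFun hf z
        rw [h2] at h1
        have h3 := h1.mapL (innerSL ℂ y)
        simp only [innerSL_apply_apply, inner_smul_right, inner_zero_right] at h3
        refine h3.congr_fun fun α => ?_
        ring) α
    have hne : (√(k.aMulti α) : ℂ) ≠ 0 := by
      exact_mod_cast (Real.sqrt_pos.mpr (k.aMulti_pos α)).ne'
    exact (mul_eq_zero.mp h).resolve_left hne

theorem Hk.apply_eq [CompleteSpace E] (f : Hk k E) (z : UnitBall d) :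
    f z = ∑' α : Fin d → ℕ, ((√(k.aMulti α) : ℂ) * monom z.1 α) • f.coord α := rfl

end Hk

section Multiplier

variable {d : ℕ} {s k : UIKernel d} {E F : Type*}
  [NormedAddCommGroup E] [InnerProductSpace ℂ E] [CompleteSpace E]
  [NormedAddCommGroup F] [InnerProductSpace ℂ F] [CompleteSpace F]

variable (s k) in
/-- `θ ∈ Mult(H_s ⊗ E, H_k ⊗ F)`: the function `θ f` is in `H_k ⊗ F` for every `f ∈ H_s ⊗ E`. -/
def IsMultiplier (θ : UnitBall d → E →L[ℂ] F) : Prop :=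
  ∀ f : Hk s E, ∃ g : Hk k F, ∀ z, g z = θ z (f z)

/-- The multiplication operator `M_θ : H_s ⊗ E → H_k ⊗ F`, `(M_θ f)(z) = θ(z) f(z)`. It is bounded
by the closed graph theorem. -/
def mulOp {θ : UnitBall d → E →L[ℂ] F} (hθ : IsMultiplier s k θ) : Hk s E →L[ℂ] Hk k F :=
  ContinuousLinearMap.ofSeqClosedGraph
    (g :=
      { toFun := fun f => (hθ f).choose
        map_add' := fun f g => RKHS.ext fun z => by
          refine ((hθ (f + g)).choose_spec z).trans ?_
          rw [RKHS.coe_add, RKHS.coe_add, Pi.add_apply, Pi.add_apply, map_add]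
          exact (congrArg₂ (· + ·) ((hθ f).choose_spec z) ((hθ g).choose_spec z)).symm
        map_smul' := fun c f => RKHS.ext fun z => by
          refine ((hθ (c • f)).choose_spec z).trans ?_
          rw [RingHom.id_apply, RKHS.coe_smul, RKHS.coe_smul, Pi.smul_apply, Pi.smul_apply,
            map_smul]
          exact (congrArg (c • ·) ((hθ f).choose_spec z)).symm })
    (by
      intro u x y hu hy
      refine RKHS.ext fun z => ?_
      have h1 := ((RKHS.continuous_eval (H := Hk k F) z).tendsto y).comp hy
      have h2 := ((θ z).continuous.tendsto _).comp
        (((RKHS.continuous_eval (H := Hk s E) z).tendsto x).comp hu)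
      refine (tendsto_nhds_unique h1 (h2.congr fun n => ?_)).trans ((hθ x).choose_spec z).symm
      exact ((hθ (u n)).choose_spec z).symm)

theorem mulOp_apply {θ : UnitBall d → E →L[ℂ] F} (hθ : IsMultiplier s k θ) (f : Hk s E)
    (z : UnitBall d) : mulOp hθ f z = θ z (f z) :=
  (hθ f).choose_spec z

/-- A partial isometry: an operator that is isometric on the orthogonal complement of its kernel. -/
def IsPartialIsometry (V : E →L[ℂ] F) : Prop :=
  ∀ x ∈ (LinearMap.ker (V : E →ₗ[ℂ] F))ᗮ, ‖V x‖ = ‖x‖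

end Multiplier

section Operators

variable {d : ℕ} (k : UIKernel d) {H : Type*} [NormedAddCommGroup H] [InnerProductSpace ℂ H]
  [CompleteSpace H]

/-- `T^α = T₁^α₁ ⋯ T_d^α_d`. -/
def tuplePow (T : Fin d → H →L[ℂ] H) (α : Fin d → ℕ) : H →L[ℂ] H :=
  (List.ofFn fun i => T i ^ α i).prod

/-- `S` is the sum, in the strong operator topology, of the series
`∑_{α ≠ 0} b_α T^α (T^α)^*`, summed over increasing degree `|α|`. -/
def IsDefectSum (T : Fin d → H →L[ℂ] H) (S : H →L[ℂ] H) : Prop :=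
  ∀ x, Filter.Tendsto (fun N : ℕ => ∑ n ∈ Finset.Icc 1 N,
    ∑ α ∈ Finset.piAntidiag Finset.univ n, (k.bMulti α : ℂ) •
      tuplePow T α (ContinuousLinearMap.adjoint (tuplePow T α) x)) Filter.atTop (nhds (S x))

/-- A commuting tuple is a `1/k`-contraction if `∑_{α ≠ 0} b_α T^α (T^α)^*` converges in the strong
operator topology to a contraction. -/
structure IsOneOverContraction (T : Fin d → H →L[ℂ] H) : Prop where
  commute : ∀ i j, Commute (T i) (T j)
  exists_sum : ∃ S : H →L[ℂ] H, IsDefectSum k T S ∧ ‖S‖ ≤ 1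

variable {k}

/-- The defect operator `Δ_T`, the positive square root of `I - ∑_{α ≠ 0} b_α T^α (T^α)^*`. -/
def defect {T : Fin d → H →L[ℂ] H} (hT : IsOneOverContraction k T) : H →L[ℂ] H :=
  CFC.sqrt (1 - hT.exists_sum.choose)

/-- `T` is pure if `∑_α a_α T^α Δ_T² (T^α)^*` converges strongly to the identity. -/
def IsPure {T : Fin d → H →L[ℂ] H} (hT : IsOneOverContraction k T) : Prop :=
  ∀ x, Filter.Tendsto (fun N : ℕ => ∑ n ∈ Finset.range N,
    ∑ α ∈ Finset.piAntidiag Finset.univ n, (k.aMulti α : ℂ) •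
      tuplePow T α ((defect hT ^ 2) (ContinuousLinearMap.adjoint (tuplePow T α) x)))
    Filter.atTop (nhds x)

/-- The Hilbert space `closure (Ran Δ_T)`. -/
def defectSpace {T : Fin d → H →L[ℂ] H} (hT : IsOneOverContraction k T) : Submodule ℂ H :=
  (LinearMap.range (defect hT : H →ₗ[ℂ] H)).topologicalClosure

instance {T : Fin d → H →L[ℂ] H} (hT : IsOneOverContraction k T) :
    CompleteSpace (defectSpace hT) :=
  (Submodule.isClosed_topologicalClosure _).completeSpace_coe

/-- `Δ_T`, as a map into `closure (Ran Δ_T)`. -/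
def defectMap {T : Fin d → H →L[ℂ] H} (hT : IsOneOverContraction k T) :
    H →L[ℂ] defectSpace hT :=
  (defect hT).codRestrict (defectSpace hT) fun x =>
    Submodule.le_topologicalClosure _ (LinearMap.mem_range_self _ x)

theorem defect_isSelfAdjoint {T : Fin d → H →L[ℂ] H} (hT : IsOneOverContraction k T) :
    IsSelfAdjoint (defect hT) :=
  IsSelfAdjoint.of_nonneg (CFC.sqrt_nonneg _)

theorem hasSum_defect {T : Fin d → H →L[ℂ] H} {hT : IsOneOverContraction k T} (hp : IsPure hT)
    (x : H) : HasSum (fun α => ‖(√(k.aMulti α) : ℂ) •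
      defectMap hT (ContinuousLinearMap.adjoint (tuplePow T α) x)‖ ^ 2) (‖x‖ ^ 2) := by
  set u : (Fin d → ℕ) → ℝ := fun α => ‖(√(k.aMulti α) : ℂ) •
      defectMap hT (ContinuousLinearMap.adjoint (tuplePow T α) x)‖ ^ 2 with hu
  have hterm : ∀ α, RCLike.re (inner ℂ ((k.aMulti α : ℂ) •
      tuplePow T α ((defect hT ^ 2) (ContinuousLinearMap.adjoint (tuplePow T α) x))) x) = u α := by
    intro α
    set y := ContinuousLinearMap.adjoint (tuplePow T α) x with hy
    have h1 : ‖defectMap hT y‖ = ‖defect hT y‖ := rfl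
    have h2 : inner ℂ (tuplePow T α ((defect hT ^ 2) y)) x
        = ((‖defect hT y‖ ^ 2 : ℝ) : ℂ) := by
      rw [← ContinuousLinearMap.adjoint_inner_right, ← hy, pow_two]
      change inner ℂ (defect hT (defect hT y)) y = _
      have := ContinuousLinearMap.adjoint_inner_left (defect hT) y (defect hT y)
      rw [(ContinuousLinearMap.isSelfAdjoint_iff'.mp (defect_isSelfAdjoint hT))] at this
      rw [this, inner_self_eq_norm_sq_to_K]
      push_cast
      rfl
    rw [inner_smul_left, h2, hu]
    simp only [Complex.conj_ofReal, ← Complex.ofReal_mul, RCLike.re_eq_complex_re,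
      Complex.ofReal_re]
    rw [norm_smul, Complex.norm_real, Real.norm_of_nonneg (Real.sqrt_nonneg _), mul_pow,
      Real.sq_sqrt (k.aMulti_pos α).le, h1]
  have hlim : Filter.Tendsto (fun N : ℕ =>
      ∑ α ∈ (Finset.range N).biUnion (fun n => Finset.piAntidiag Finset.univ n), u α)
      Filter.atTop (nhds (‖x‖ ^ 2)) := by
    have h1 := (Complex.continuous_re.tendsto _).comp
      ((hp x).inner (tendsto_const_nhds (x := x)) (𝕜 := ℂ))
    have h2 : (inner ℂ x x : ℂ).re = ‖x‖ ^ 2 := by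
      rw [inner_self_eq_norm_sq_to_K]
      norm_cast
    rw [h2] at h1
    refine h1.congr fun N => ?_
    rw [sum_biUnion_degree, Function.comp_apply, sum_inner, Complex.re_sum]
    refine Finset.sum_congr rfl fun n _ => ?_
    rw [sum_inner, Complex.re_sum]
    exact Finset.sum_congr rfl fun α _ => hterm α
  have hnn : ∀ α, 0 ≤ u α := fun α => by positivity
  have hmono : Monotone fun N : ℕ =>
      ∑ α ∈ (Finset.range N).biUnion (fun n => Finset.piAntidiag Finset.univ n), u α := by
    intro M N hMN
    refine Finset.sum_le_sum_of_subset_of_nonneg (Finset.biUnion_subset_biUnion_of_subset_left _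
      (Finset.range_mono hMN)) fun α _ _ => hnn α
  have hsum : Summable u := by
    refine summable_of_sum_le hnn (c := ‖x‖ ^ 2) fun s => ?_
    obtain ⟨N, hN⟩ := exists_subset_degree s
    exact (Finset.sum_le_sum_of_subset_of_nonneg (hN N le_rfl) fun α _ _ => hnn α).trans
      (hmono.ge_of_tendsto hlim N)
  have htend : Filter.Tendsto (fun N : ℕ =>
      (Finset.range N).biUnion (fun n => Finset.piAntidiag (Finset.univ : Finset (Fin d)) n))
      Filter.atTop Filter.atTop :=
    Filter.tendsto_atTop.mpr fun s => by
      obtain ⟨N, hN⟩ := exists_subset_degree s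
      filter_upwards [Filter.eventually_ge_atTop N] with M hM using hN M hM
  have h := hsum.hasSum
  rwa [tendsto_nhds_unique (h.comp htend) hlim] at h

/-- The isometry `V_T : H → H_k ⊗ closure (Ran Δ_T)`, `V_T h = ∑_α a_α z^α ⊗ Δ_T (T^α)^* h`; the
coordinates of `V_T h` are therefore `√a_α Δ_T (T^α)^* h`. -/
def isometryV {T : Fin d → H →L[ℂ] H} {hT : IsOneOverContraction k T} (hp : IsPure hT) :
    H →ₗᵢ[ℂ] Hk k (defectSpace hT) where
  toFun h := Hk.mk (fun α => (√(k.aMulti α) : ℂ) •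
      defectMap hT (ContinuousLinearMap.adjoint (tuplePow T α) h)) (hasSum_defect hp h).summable
  map_add' x y := Hk.ext_coord fun α => by
    rw [Hk.coord_add, Hk.coord_mk, Hk.coord_mk, Hk.coord_mk, map_add, map_add, smul_add]
  map_smul' c x := Hk.ext_coord fun α => by
    rw [RingHom.id_apply, Hk.coord_smul, Hk.coord_mk, Hk.coord_mk, map_smul, map_smul, smul_comm]
  norm_map' x := by
    rw [← sq_eq_sq₀ (norm_nonneg _) (norm_nonneg _)]
    exact (Hk.hasSum_norm_sq _).unique (hasSum_defect hp x)

theorem isometryV_apply {T : Fin d → H →L[ℂ] H} {hT : IsOneOverContraction k T} (hp : IsPure hT)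
    (h : H) (z : UnitBall d) : isometryV hp h z = ∑' α, ((k.aMulti α : ℂ) * monom z.1 α) •
      defectMap hT (ContinuousLinearMap.adjoint (tuplePow T α) h) := by
  rw [Hk.apply_eq]
  refine tsum_congr fun α => ?_
  change ((√(k.aMulti α) : ℂ) * monom z.1 α) • ((√(k.aMulti α) : ℂ) • _) = _
  rw [smul_smul]
  congr 1
  have : (√(k.aMulti α) : ℂ) * √(k.aMulti α) = k.aMulti α := by
    exact_mod_cast Real.mul_self_sqrt (k.aMulti_pos α).le
  rw [← this]
  ring

variable (k) in
/-- `T` is unitarily equivalent to `(M_{z_1} ⊗ I_E, …, M_{z_d} ⊗ I_E)` on `H_k ⊗ E`. -/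
def IsUnitarilyEquivalentToShift (T : Fin d → H →L[ℂ] H) (E : Type*) [NormedAddCommGroup E]
    [InnerProductSpace ℂ E] [CompleteSpace E] : Prop :=
  ∃ U : H ≃ₗᵢ[ℂ] Hk k E, ∀ (i : Fin d) (h : H) (z : UnitBall d), U (T i h) z = z.1 i • U h z

end Operators

section Kernels

variable {d : ℕ} (k : UIKernel d)

/-- The coordinate function `z_i`, acting on `ℂ` by multiplication. -/
def coordFun (i : Fin d) (z : UnitBall d) : ℂ →L[ℂ] ℂ := z.1 i • ContinuousLinearMap.id ℂ ℂ

/-- Admissible kernels: the multiplications `M_{z_i}` are bounded on `H_k` and form a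
`1/k`-contraction. -/
def IsAdmissible : Prop :=
  ∃ h : ∀ i : Fin d, IsMultiplier k k (coordFun i),
    IsOneOverContraction k fun i => mulOp (h i)

/-- The `M_{m × n}` Nevanlinna-Pick property: if the block matrix
`[(I - W_i W_j^*) k(λ_i, λ_j)]_{i,j}` is positive semidefinite, then some multiplier `φ` in the
closed unit ball of `Mult(H_k ⊗ ℂ^n, H_k ⊗ ℂ^m)` satisfies `φ(λ_i) = W_i`. -/
def HasNPProperty (m n : ℕ) : Prop :=
  ∀ (N : ℕ) (pt : Fin N → UnitBall d) (W : Fin N → Matrix (Fin m) (Fin n) ℂ),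
    (Matrix.of fun p q : Fin N × Fin m =>
      (1 - W p.1 * (W q.1).conjTranspose : Matrix (Fin m) (Fin m) ℂ) p.2 q.2 * k.ker (pt p.1) (pt q.1)).PosSemidef →
    ∃ (φ : UnitBall d → EuclideanSpace ℂ (Fin n) →L[ℂ] EuclideanSpace ℂ (Fin m))
      (hφ : IsMultiplier k k φ), ‖mulOp hφ‖ ≤ 1 ∧
        ∀ i, φ (pt i) = (Matrix.toEuclideanLin (W i)).toContinuousLinearMap

/-- The function `k_w = k(·, w)`. -/
def UIKernel.kerAt (w : UnitBall d) : UnitBall d → ℂ := fun z => k.ker z w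

/-- `H_k` is irreducible: `k` has no zeros, and `k_v`, `k_w` are linearly independent if `v ≠ w`. -/
def IsIrreducibleKernel : Prop :=
  (∀ z w, k.ker z w ≠ 0) ∧
    ∀ v w : UnitBall d, v ≠ w → LinearIndependent ℂ ![k.kerAt v, k.kerAt w]

/-- Unitarily invariant complete Nevanlinna-Pick kernels. -/
def IsCNP : Prop :=
  IsIrreducibleKernel k ∧ ∀ m n : ℕ, 0 < m → 0 < n → HasNPProperty k m n

end Kernels

end CNPFactor

end

universe u v w

open CNPFactor

/-! Since $V_T$ is an isometry, $P = I - V_TV_T^*$ is a projection, and the hypotheses say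
$M_{\theta_1}M_{\theta_1}^* = P = M_{\theta_2}M_{\theta_2}^*$. Hence
$M_{\theta_i}M_{\theta_i}^*M_{\theta_i} = M_{\theta_i}$ (`comp_adjoint_comp_of_one_sub`), and $V_m =
M_{\theta_2}^*M_{\theta_1}$ settles the first claim algebraically.

On kernel functions the equality of the two operators reads $s_1(z,w)\theta_1(z)\theta_1(w)^* =
s_2(z,w)\theta_2(z)\theta_2(w)^*$. If $s_1 = s_2$, the nonvanishing kernel cancels. The families
$\theta_i(w)^*x$ then have the same Gram matrix, so a partial isometry matches them
(`exists_isPartialIsometry_of_inner_eq`).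

Conversely, $V_f$ gives $\theta_1(z)\theta_1(w)^* = \theta_2(z)\theta_2(w)^*$, hence
$(s_1-s_2)(z,w)\,\theta_1(z)\theta_1(w)^* = 0$. If $s_1 \ne s_2$, the identity theorem on discs
through the origin forces $M_{\theta_1} = 0$ (`mulOp_eq_zero_of_ker_ne`). Then $V_TV_T^* = I$, so
$V_T$ is unitary and carries $T$ to the shift (`isUnitarilyEquivalentToShift_of_surjective`),
against non-triviality. -/

namespace CNPFactor

open ContinuousLinearMap Filter Topology

/-! ### Partial isometries and Gram matrices -/

section PartialIsometry

variable {E F : Type*}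
  [NormedAddCommGroup E] [InnerProductSpace ℂ E] [CompleteSpace E]
  [NormedAddCommGroup F] [InnerProductSpace ℂ F] [CompleteSpace F]

/-- The vector $V^*Vx - x$ lies in $\ker V$. For $x \perp \ker V$ it is orthogonal both to $x$ and
to $V^*Vx$, hence to itself, so $V^*Vx = x$. -/
theorem IsPartialIsometry.of_apply_adjoint_apply {V : E →L[ℂ] F}
    (h : ∀ x, V (adjoint V (V x)) = V x) : IsPartialIsometry V := by
  intro x hx
  have hy : V (adjoint V (V x) - x) = 0 := by rw [map_sub, h, sub_self]
  have h1 : inner ℂ (adjoint V (V x) - x) x = 0 := hx _ hy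
  have h2 : inner ℂ (adjoint V (V x) - x) (adjoint V (V x)) = 0 := by
    rw [adjoint_inner_right, hy, inner_zero_left]
  have h3 : adjoint V (V x) = x := by
    rw [← sub_eq_zero, ← inner_self_eq_zero (𝕜 := ℂ), inner_sub_right, h1, h2, sub_zero]
  rw [← sq_eq_sq₀ (norm_nonneg _) (norm_nonneg _), ← inner_self_eq_norm_sq (𝕜 := ℂ),
    ← inner_self_eq_norm_sq (𝕜 := ℂ), ← adjoint_inner_left, h3]

/-- Two families of vectors with the same Gram matrix correspond under a partial isometry. -/
theorem exists_isPartialIsometry_of_inner_eq {ι : Type*} {a : ι → E} {b : ι → F}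
    (hab : ∀ i j, inner ℂ (a i) (a j) = inner ℂ (b i) (b j)) :
    ∃ V : E →L[ℂ] F, IsPartialIsometry V ∧ (∀ i, V (a i) = b i) ∧ ∀ i, adjoint V (b i) = a i := by
  set K : Submodule ℂ E := (Submodule.span ℂ (Set.range a)).topologicalClosure
  have : CompleteSpace K := (Submodule.isClosed_topologicalClosure _).completeSpace_coe
  have haK : ∀ i, a i ∈ K := fun i =>
    Submodule.le_topologicalClosure _ (Submodule.subset_span ⟨i, rfl⟩)
  -- Formal combinations avoid choosing a basis: equal Gram matrices give $\|f c\| = \|e c\|$, so $e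
  -- c \mapsto f c$ is well defined and isometric on the dense range of `e`.
  let e : (ι →₀ ℂ) →ₗ[ℂ] K := Finsupp.linearCombination ℂ fun i => (⟨a i, haK i⟩ : K)
  let f : (ι →₀ ℂ) →ₗ[ℂ] F := Finsupp.linearCombination ℂ b
  have he : ∀ c, (e c : E) = Finsupp.linearCombination ℂ a c := fun c => by
    simp [e, Finsupp.linearCombination_apply, Finsupp.sum]
  have hnorm : ∀ c, ‖f c‖ = ‖e c‖ := fun c => by
    change ‖f c‖ = ‖(e c : E)‖
    rw [he, ← sq_eq_sq₀ (norm_nonneg _) (norm_nonneg _),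
      ← inner_self_eq_norm_sq (𝕜 := ℂ), ← inner_self_eq_norm_sq (𝕜 := ℂ)]
    simp [f, Finsupp.linearCombination_apply, Finsupp.sum_inner, Finsupp.inner_sum, hab,
      -inner_self_eq_norm_sq_to_K]
  have hdense : DenseRange e := by
    intro x
    rw [Topology.IsInducing.subtypeVal.closure_eq_preimage_closure_image]
    have hx : (x : E) ∈ closure (Submodule.span ℂ (Set.range a) : Set E) := x.2
    refine closure_mono ?_ hx
    intro y hy
    obtain ⟨c, rfl⟩ := (Finsupp.mem_span_range_iff_exists_finsupp).mp hy
    exact ⟨e c, ⟨c, rfl⟩, he c⟩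
  -- The isometric extension to `K`, made zero on `Kᗮ` by the projection.
  let V : E →L[ℂ] F := f.extendOfNorm e ∘L K.orthogonalProjectionOnto
  have hVa : ∀ i, V (a i) = b i := fun i => by
    have h1 : K.orthogonalProjectionOnto (a i) = e (Finsupp.single i 1) := by
      refine (Submodule.orthogonalProjectionOnto_mem_subspace_eq_self (⟨a i, haK i⟩ : K)).trans ?_
      simp [e]
    change f.extendOfNorm e (K.orthogonalProjectionOnto (a i)) = b i
    rw [h1, LinearMap.extendOfNorm_eq hdense ⟨1, fun c => by rw [one_mul, hnorm]⟩]
    simp [f]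
  have hV0 : ∀ x ∈ Kᗮ, V x = 0 := fun x hx => by
    change f.extendOfNorm e (K.orthogonalProjectionOnto x) = 0
    rw [Submodule.orthogonalProjectionOnto_apply_of_mem_orthogonal hx, map_zero]
  -- The remaining identities say that a continuous operator vanishes; its kernel is closed, so it
  -- is enough to test it on the `a i` and on `Kᗮ`.
  have hind : ∀ p : Submodule ℂ E, IsClosed (p : Set E) → (∀ i, a i ∈ p) → (∀ x ∈ Kᗮ, x ∈ p) →
      ∀ x, x ∈ p := by
    intro p hp h1 h2 x
    have h3 : K ≤ p := Submodule.topologicalClosure_minimal _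
      (Submodule.span_le.mpr (by rintro _ ⟨i, rfl⟩; exact h1 i)) hp
    obtain ⟨y, hy, z, hz, rfl⟩ := K.exists_add_mem_mem_orthogonal x
    exact p.add_mem (h3 hy) (h2 z hz)
  have hadj : ∀ i, adjoint V (b i) = a i := by
    intro i
    refine ext_inner_right ℂ fun x => sub_eq_zero.mp ?_
    let A := innerSL ℂ (adjoint V (b i)) - innerSL ℂ (a i)
    refine hind (LinearMap.ker (A : E →ₗ[ℂ] ℂ)) A.isClosed_ker (fun j => ?_) (fun y hy => ?_) x
    · simp [A, adjoint_inner_left, hVa, hab]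
    · have := hy (a i) (haK i)
      simp [A, adjoint_inner_left, hV0 y hy, this]
  refine ⟨V, IsPartialIsometry.of_apply_adjoint_apply fun x => sub_eq_zero.mp ?_, hVa, hadj⟩
  let A := V ∘L adjoint V ∘L V - V
  exact hind (LinearMap.ker (A : E →ₗ[ℂ] F)) A.isClosed_ker (fun i => by simp [A, hVa, hadj])
    (fun x hx => by simp [A, hV0 x hx]) x

/-- From $W^*W = 1$ one gets $MM^*W = 0$, hence $M^*W = 0$ and $W^*M = 0$. Therefore $MM^*M = M -
WW^*M = M$. -/
theorem comp_adjoint_comp_of_one_sub {H : Type*} [NormedAddCommGroup H] [InnerProductSpace ℂ H]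
    [CompleteSpace H] (W : H →ₗᵢ[ℂ] F) {M : E →L[ℂ] F}
    (h : 1 - W.toContinuousLinearMap ∘L adjoint W.toContinuousLinearMap = M ∘L adjoint M) (x : E) :
    M (adjoint M (M x)) = M x := by
  have hW : ∀ y, adjoint W.toContinuousLinearMap (W y) = y := fun y => by
    refine ext_inner_right ℂ fun z => ?_
    rw [adjoint_inner_left]
    exact W.inner_map_map y z
  have hP : ∀ y, M (adjoint M y) = y - W (adjoint W.toContinuousLinearMap y) := fun y =>
    (congrArg (fun A : F →L[ℂ] F => A y) h).symm
  have h1 : ∀ y, adjoint M (W y) = 0 := fun y => by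
    rw [← inner_self_eq_zero (𝕜 := ℂ), adjoint_inner_right, hP, hW, sub_self, inner_zero_left]
  have h2 : adjoint W.toContinuousLinearMap (M x) = 0 := by
    refine ext_inner_right ℂ fun z => ?_
    rw [adjoint_inner_left, inner_zero_left, ← adjoint_inner_right]
    exact (congrArg _ (h1 z)).trans (inner_zero_right _)
  rw [hP, h2, map_zero, sub_zero]

end PartialIsometry

/-- A power series in one variable that vanishes at points tending to `0` is zero. -/
theorem coeff_eq_zero_of_frequently {E : Type*} [NormedAddCommGroup E] [NormedSpace ℂ E]
    {c : ℕ → E} {F : ℂ → E} (hF : ∀ᶠ t in 𝓝 0, HasSum (fun n => t ^ n • c n) (F t))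
    (h0 : ∃ᶠ t in 𝓝[≠] 0, F t = 0) (n : ℕ) : c n = 0 := by
  set p : FormalMultilinearSeries ℂ ℂ E :=
    fun n => ContinuousMultilinearMap.mkPiRing ℂ (Fin n) (c n) with hp
  have hc : ∀ n, p.coeff n = c n := fun n => by simp [hp, FormalMultilinearSeries.coeff]
  have hps : HasFPowerSeriesAt F p 0 := by
    rw [hasFPowerSeriesAt_iff]
    filter_upwards [hF] with t ht
    simpa only [hc, zero_add] using ht
  have h1 := hps.analyticAt.frequently_zero_iff_eventually_zero.mp h0
  have h2 : p = 0 := (hps.congr h1).eq_zero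
  rw [← hc, h2]
  exact FormalMultilinearSeries.coeff_eq_zero.mpr rfl

/-! ### Reproducing kernels and restriction to discs through the origin -/

section Hk

variable {d : ℕ} {k : UIKernel d} {E : Type*} [NormedAddCommGroup E] [InnerProductSpace ℂ E]

theorem monom_smul (t : ℂ) (z : EuclideanSpace ℂ (Fin d)) (α : Fin d → ℕ) :
    monom (t • z) α = t ^ (∑ i, α i) * monom z α := by
  simp only [monom, PiLp.smul_apply, smul_eq_mul, mul_pow, Finset.prod_mul_distrib,
    Finset.prod_pow_eq_pow_sum]

/-- A sum over all multi-indices, arranged by degree. -/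
theorem hasSum_degree {A : Type*} [NormedAddCommGroup A] [CompleteSpace A]
    {f : (Fin d → ℕ) → A} {x : A}
    (h : HasSum f x) :
    HasSum (fun n => ∑ α ∈ Finset.piAntidiag Finset.univ n, f α) x := by
  refine (h.tsum_fiberwise (fun α => ∑ i, α i)).congr_fun fun n => ?_
  have hset : (fun α : Fin d → ℕ => ∑ i, α i) ⁻¹' {n}
      = ((Finset.piAntidiag Finset.univ n : Finset (Fin d → ℕ)) : Set (Fin d → ℕ)) := by
    ext α
    simp
  rw [hset, Finset.tsum_subtype' (Finset.piAntidiag Finset.univ n) f]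

theorem Hk.hasSum_inner (f g : Hk k E) :
    HasSum (fun α => inner ℂ (f.coord α) (g.coord α)) (inner ℂ f g) :=
  lp.hasSum_inner (𝕜 := ℂ) (show lp (fun _ : Fin d → ℕ => E) 2 from f)
    (show lp (fun _ : Fin d → ℕ => E) 2 from g)

/-- The element of `H_k(E)` whose coordinates vanish except for one. -/
def Hk.single (k : UIKernel d) (α : Fin d → ℕ) (x : E) : Hk k E :=
  Hk.mk (Pi.single α x) (summable_of_ne_finset_zero (s := {α}) fun β hβ => by
    rw [Pi.single_eq_of_ne (by simpa using hβ)]; simp)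

theorem Hk.coord_single (α : Fin d → ℕ) (x : E) (β : Fin d → ℕ) :
    (Hk.single k α x).coord β = (Pi.single α x : (Fin d → ℕ) → E) β := rfl

theorem Hk.inner_single (f : Hk k E) (α : Fin d → ℕ) (x : E) :
    inner ℂ f (Hk.single k α x) = inner ℂ (f.coord α) x := by
  refine (Hk.hasSum_inner f _).unique ?_
  have := hasSum_single (f := fun β => inner ℂ (f.coord β) ((Hk.single k α x).coord β)) α
    (fun β hβ => by rw [Hk.coord_single, Pi.single_eq_of_ne hβ, inner_zero_right])
  rwa [Hk.coord_single, Pi.single_eq_same] at this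

variable [CompleteSpace E]

theorem Hk.hasSum_apply (f : Hk k E) (z : UnitBall d) :
    HasSum (fun α => ((√(k.aMulti α) : ℂ) * monom z.1 α) • f.coord α) (f z) :=
  (Hk.summable_eval f z).hasSum

/-- Constant functions. -/
theorem Hk.single_zero_apply (x : E) (z : UnitBall d) : Hk.single k 0 x z = x := by
  refine (Hk.hasSum_apply _ z).unique ?_
  have := hasSum_single (f := fun β => ((√(k.aMulti β) : ℂ) * monom z.1 β) •
    (Hk.single k 0 x).coord β) 0
    (fun β hβ => by rw [Hk.coord_single, Pi.single_eq_of_ne hβ, smul_zero])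
  simpa [Hk.coord_single, UIKernel.aMulti, k.a_zero, monom, Nat.multinomial] using this

/-- The reproducing kernel of `H_k(E)`. -/
theorem Hk.kerFun_apply (w : UnitBall d) (x : E) (z : UnitBall d) :
    RKHS.kerFun (Hk k E) w x z = k.ker z w • x := by
  have hsum : ∀ α, ‖((√(k.aMulti α) : ℂ) * starRingEnd ℂ (monom w.1 α)) • x‖ ^ 2
      = k.aMulti α * ‖monom w.1 α‖ ^ 2 * ‖x‖ ^ 2 := fun α => by
    rw [norm_smul, norm_mul, Complex.norm_real, Real.norm_of_nonneg (Real.sqrt_nonneg _),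
      RCLike.norm_conj, mul_pow, mul_pow, Real.sq_sqrt (k.aMulti_pos α).le]
  -- These coordinates are the conjugates of the orthonormal monomials at `w`, times `x`; pairing
  -- with them is evaluation at `w` followed by pairing with `x`.
  let g : Hk k E := Hk.mk
    (fun α => ((√(k.aMulti α) : ℂ) * starRingEnd ℂ (monom w.1 α)) • x) (by
      simp only [hsum]
      exact (summable_aMulti k w).mul_right _)
  have hg : RKHS.kerFun (Hk k E) w x = g := by
    refine ext_inner_right ℂ fun f => ?_
    rw [RKHS.kerFun_inner]
    refine (((Hk.hasSum_apply f w).mapL (innerSL ℂ x)).unique ?_)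
    refine (Hk.hasSum_inner g f).congr_fun fun α => ?_
    change inner ℂ x _ = inner ℂ (((√(k.aMulti α) : ℂ) * starRingEnd ℂ (monom w.1 α)) • x) _
    rw [inner_smul_left, inner_smul_right]
    simp
  rw [hg]
  have h1 := Hk.hasSum_apply g z
  have h2 := hasSum_degree h1
  -- `ker` is a series in $\langle z,w\rangle$, so the multi-index series has to be collected by
  -- degree before the two can be compared.
  have h3 : ∀ n, ∑ α ∈ Finset.piAntidiag Finset.univ n,
      ((√(k.aMulti α) : ℂ) * monom z.1 α) • g.coord α
      = ((k.a n : ℂ) * inner ℂ w.1 z.1 ^ n) • x := fun n => by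
    rw [← sum_degree, Finset.sum_smul]
    refine Finset.sum_congr rfl fun α _ => ?_
    change _ • (((√(k.aMulti α) : ℂ) * starRingEnd ℂ (monom w.1 α)) • x) = _
    have : (√(k.aMulti α) : ℂ) * √(k.aMulti α) = k.aMulti α := by
      exact_mod_cast Real.mul_self_sqrt (k.aMulti_pos α).le
    rw [smul_smul, ← this]
    congr 1
    ring
  simp only [h3] at h2
  exact h2.unique ((k.summable z w).hasSum.smul_const x)

/-- The homogeneous part of degree `n`, at `z`, of the power series of `f`. -/
noncomputable def Hk.homog (f : Hk k E) (z : EuclideanSpace ℂ (Fin d)) (n : ℕ) : E :=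
  ∑ α ∈ Finset.piAntidiag Finset.univ n, ((√(k.aMulti α) : ℂ) * monom z α) • f.coord α

/-- Each monomial of degree $n$ scales by $t^n$, so $t \mapsto f(tz)$ is a power series in one
variable. -/
theorem Hk.hasSum_homog (f : Hk k E) (z : EuclideanSpace ℂ (Fin d)) (t : ℂ)
    (h : t • z ∈ Metric.ball (0 : EuclideanSpace ℂ (Fin d)) 1) :
    HasSum (fun n => t ^ n • f.homog z n) (f ⟨t • z, h⟩) := by
  refine (hasSum_degree (Hk.hasSum_apply f ⟨t • z, h⟩)).congr_fun fun n => ?_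
  rw [Hk.homog, Finset.smul_sum]
  refine Finset.sum_congr rfl fun α hα => ?_
  have h2 : ∑ i, α i = n := by simpa using hα
  rw [monom_smul, h2, smul_smul]
  congr 1
  ring

/-- The bound on `t` is not strict because the identity theorem is later used at $t = 1$. -/
theorem smul_mem_ball (z : UnitBall d) {t : ℂ} (ht : ‖t‖ ≤ 1) :
    t • z.1 ∈ Metric.ball (0 : EuclideanSpace ℂ (Fin d)) 1 := by
  have hz : ‖z.1‖ < 1 := mem_ball_zero_iff.mp z.2
  rw [mem_ball_zero_iff, norm_smul]
  nlinarith [norm_nonneg t, norm_nonneg z.1]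

/-- A function in `H_k(E)` that vanishes on a punctured neighbourhood of `0` in a disc through `0`
vanishes on the disc. -/
theorem Hk.apply_smul_eq_zero_of_eventually (f : Hk k E) (z : UnitBall d)
    (h : ∀ᶠ t : ℂ in 𝓝[≠] 0, ∀ ht : t • z.1 ∈ Metric.ball (0 : EuclideanSpace ℂ (Fin d)) 1,
      f ⟨t • z.1, ht⟩ = 0)
    (t : ℂ) (ht : t • z.1 ∈ Metric.ball (0 : EuclideanSpace ℂ (Fin d)) 1) : f ⟨t • z.1, ht⟩ = 0 := by
  have hball : ∀ᶠ t : ℂ in 𝓝 0, t • z.1 ∈ Metric.ball (0 : EuclideanSpace ℂ (Fin d)) 1 := by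
    filter_upwards [Metric.closedBall_mem_nhds (0 : ℂ) one_pos] with t ht
    exact smul_mem_ball z (by simpa using ht)
  -- The sum of the series, a function of every `t`, replaces $f(tz)$, which makes sense only when
  -- $tz$ is in the ball.
  have h1 := coeff_eq_zero_of_frequently (c := f.homog z.1)
    (F := fun t => ∑' n, t ^ n • f.homog z.1 n)
    (by filter_upwards [hball] with t ht using (Hk.hasSum_homog f z.1 t ht).summable.hasSum)
    (Eventually.frequently (by
      filter_upwards [h, nhdsWithin_le_nhds hball] with t ht hb
      rw [(Hk.hasSum_homog f z.1 t hb).tsum_eq, ht hb]))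
  have h2 := Hk.hasSum_homog f z.1 t ht
  simp only [h1, smul_zero] at h2
  exact h2.unique hasSum_zero

end Hk

/-! ### Multipliers on kernel functions and vanishing of multipliers -/

section Multiplier

variable {d : ℕ} {s k : UIKernel d} {E F : Type*}
  [NormedAddCommGroup E] [InnerProductSpace ℂ E] [CompleteSpace E]
  [NormedAddCommGroup F] [InnerProductSpace ℂ F] [CompleteSpace F]

theorem adjoint_mulOp_kerFun {θ : UnitBall d → E →L[ℂ] F} (hθ : IsMultiplier s k θ)
    (w : UnitBall d) (x : F) :
    adjoint (mulOp hθ) (RKHS.kerFun (Hk k F) w x) = RKHS.kerFun (Hk s E) w (adjoint (θ w) x) := by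
  refine ext_inner_right ℂ fun f => ?_
  rw [adjoint_inner_left, RKHS.kerFun_inner, RKHS.kerFun_inner, mulOp_apply, adjoint_inner_left]

/-- This translates an identity between operators $M_\theta M_\theta^*$ into a pointwise identity
for $s(z,w)\theta(z)\theta(w)^*$. -/
theorem mulOp_adjoint_mulOp_kerFun {θ : UnitBall d → E →L[ℂ] F} (hθ : IsMultiplier s k θ)
    (w : UnitBall d) (x : F) (z : UnitBall d) :
    mulOp hθ (adjoint (mulOp hθ) (RKHS.kerFun (Hk k F) w x)) z
      = s.ker z w • θ z (adjoint (θ w) x) := by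
  rw [adjoint_mulOp_kerFun, mulOp_apply, Hk.kerFun_apply, map_smul]

theorem exists_coeff_ne_of_ker_ne {s₁ s₂ : UIKernel d} (h : s₁.ker ≠ s₂.ker) :
    ∃ n, s₁.a n ≠ s₂.a n := by
  contrapose! h
  funext z w
  simp only [UIKernel.ker, h]

/-- On a disc through the origin, two different unitarily invariant kernels agree at isolated points
only. -/
theorem eventually_ker_ne {s₁ s₂ : UIKernel d} (h : s₁.ker ≠ s₂.ker) {z : UnitBall d}
    (hz : z.1 ≠ 0) : ∀ᶠ t : ℂ in 𝓝[≠] 0,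
      ∀ ht : t • z.1 ∈ Metric.ball (0 : EuclideanSpace ℂ (Fin d)) 1,
        s₁.ker ⟨t • z.1, ht⟩ z ≠ s₂.ker ⟨t • z.1, ht⟩ z := by
  obtain ⟨n, hn⟩ := exists_coeff_ne_of_ker_ne h
  by_contra hcon
  -- On the disc, $\langle tz, z\rangle = tr$. As $r \ne 0$, vanishing of the coefficients `c n`
  -- gives back $a_n^{(s_1)} = a_n^{(s_2)}$.
  set r : ℂ := inner ℂ z.1 z.1 with hr
  have hr0 : r ≠ 0 := inner_self_ne_zero.mpr hz
  set c : ℕ → ℂ := fun n => ((s₁.a n : ℂ) - s₂.a n) * r ^ n with hc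
  have hs : ∀ (t : ℂ) (ht : t • z.1 ∈ Metric.ball (0 : EuclideanSpace ℂ (Fin d)) 1),
      HasSum (fun n : ℕ => t ^ n • c n) (s₁.ker ⟨t • z.1, ht⟩ z - s₂.ker ⟨t • z.1, ht⟩ z) := by
    intro t ht
    refine ((s₁.summable ⟨t • z.1, ht⟩ z).hasSum.sub
      (s₂.summable ⟨t • z.1, ht⟩ z).hasSum).congr_fun fun n => ?_
    simp only [inner_smul_right, ← hr, hc, smul_eq_mul, mul_pow]
    ring
  have h0 := coeff_eq_zero_of_frequently (c := c) (F := fun t => ∑' n : ℕ, t ^ n • c n)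
    (by
      filter_upwards [Metric.closedBall_mem_nhds (0 : ℂ) one_pos] with t ht
      exact (hs t (smul_mem_ball z (by simpa using ht))).summable.hasSum)
    (by
      refine (not_eventually.mp hcon).mono fun t ht => ?_
      push Not at ht
      obtain ⟨hb, he⟩ := ht
      rw [(hs t hb).tsum_eq, he, sub_self]) n
  refine hn ?_
  have := (mul_eq_zero.mp h0).resolve_right (pow_ne_zero _ hr0)
  exact_mod_cast sub_eq_zero.mp this

/-- If `θ(z) θ(w)^*` is annihilated by the difference of two different unitarily invariant kernels,
then the multiplier `θ` vanishes. -/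
theorem mulOp_eq_zero_of_ker_ne (hd : 1 ≤ d) {s₁ s₂ : UIKernel d} (h : s₁.ker ≠ s₂.ker)
    {θ : UnitBall d → E →L[ℂ] F} (hθ : IsMultiplier s k θ)
    (hker : ∀ z w x, s₁.ker z w • θ z (adjoint (θ w) x) = s₂.ker z w • θ z (adjoint (θ w) x)) :
    mulOp hθ = 0 := by
  have hθ0 : ∀ z : UnitBall d, z.1 ≠ 0 → ∀ e, θ z e = 0 := by
    intro z hz e
    have hx : ∀ x, adjoint (θ z) x = 0 := by
      intro x
      -- Applying $M_\theta$ to a constant function makes $v \mapsto \theta(v)\theta(z)^*x$ an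
      -- element of $H_k \otimes F$. It vanishes at $v = tz$ for small $t \ne 0$, hence also at $t =
      -- 1$, which gives $\theta(z)\theta(z)^*x = 0$.
      have hf : ∀ v, mulOp hθ (Hk.single s 0 (adjoint (θ z) x)) v = θ v (adjoint (θ z) x) :=
        fun v => by rw [mulOp_apply, Hk.single_zero_apply]
      have h1 := Hk.apply_smul_eq_zero_of_eventually
        (mulOp hθ (Hk.single s 0 (adjoint (θ z) x))) z (by
          filter_upwards [eventually_ker_ne h hz] with t ht hb
          rw [hf]
          have h2 := sub_eq_zero.mpr (hker ⟨t • z.1, hb⟩ z x)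
          rw [← sub_smul] at h2
          exact (smul_eq_zero.mp h2).resolve_left (sub_ne_zero.mpr (ht hb))) 1
        (smul_mem_ball z (by simp))
      rw [hf] at h1
      simp only [one_smul] at h1
      rw [← inner_self_eq_zero (𝕜 := ℂ), adjoint_inner_left]
      exact (congrArg _ h1).trans (inner_zero_right _)
    refine ext_inner_left ℂ fun x => ?_
    rw [← adjoint_inner_left, hx, inner_zero_left, inner_zero_right]
  ext f : 1
  refine RKHS.ext fun z => ?_
  rw [zero_apply, RKHS.coe_zero, Pi.zero_apply]
  -- The disc through $z = 0$ is degenerate. The value at the origin comes instead from the disc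
  -- through a nonzero point $v$, which exists since $d \ge 1$.
  by_cases hz : z.1 = 0
  · have hv : ((1 / 2 : ℂ) • EuclideanSpace.single (⟨0, hd⟩ : Fin d) (1 : ℂ))
        ∈ Metric.ball (0 : EuclideanSpace ℂ (Fin d)) 1 := by
      rw [mem_ball_zero_iff, norm_smul]
      norm_num
    set v : UnitBall d := ⟨_, hv⟩ with hvdef
    have hv0 : v.1 ≠ 0 := by simp [hvdef]
    have h1 := Hk.apply_smul_eq_zero_of_eventually (mulOp hθ f) v (by
      filter_upwards [self_mem_nhdsWithin] with t ht hb
      rw [mulOp_apply, hθ0 _ (smul_ne_zero ht hv0)]) 0 (smul_mem_ball v (by simp))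
    convert h1 using 2
    exact Subtype.ext (hz.trans (zero_smul ℂ v.1).symm)
  · rw [mulOp_apply, hθ0 z hz]

end Multiplier

/-! ### A surjective $V_T$ identifies $T$ with the shift -/

section Shift

variable {d : ℕ} {k : UIKernel d} {H : Type*} [NormedAddCommGroup H] [InnerProductSpace ℂ H]

theorem prod_pow_add_single {M : Type*} [CommMonoid M] (x : Fin d → M) (i : Fin d)
    (α : Fin d → ℕ) :
    ∏ j, x j ^ (α + Pi.single i 1 : Fin d → ℕ) j = x i * ∏ j, x j ^ α j := by
  simp only [Pi.add_apply, pow_add, Finset.prod_mul_distrib]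
  rw [mul_comm, Finset.prod_eq_single i (fun j _ hj => by rw [Pi.single_eq_of_ne hj, pow_zero])
    (fun h => absurd (Finset.mem_univ i) h), Pi.single_eq_same, pow_one]

open scoped IsMulCommutative in
-- `tuplePow` is an ordered product; inside the commutative algebra generated by the $T_i$ it
-- becomes a `Finset` product, whose factors can be rearranged.
theorem tuplePow_add_single {T : Fin d → H →L[ℂ] H} (hT : ∀ i j, Commute (T i) (T j)) (i : Fin d)
    (α : Fin d → ℕ) : tuplePow T (α + Pi.single i 1) = T i ∘L tuplePow T α := by
  have := Algebra.isMulCommutative_adjoin ℂ (s := Set.range T)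
    (by rintro _ ⟨i, rfl⟩ _ ⟨j, rfl⟩; exact hT i j)
  let t : Fin d → Algebra.adjoin ℂ (Set.range T) :=
    fun i => ⟨T i, Algebra.subset_adjoin ⟨i, rfl⟩⟩
  have h : ∀ β, tuplePow T β = ((∏ j, t j ^ β j : Algebra.adjoin ℂ (Set.range T)) : H →L[ℂ] H) := by
    intro β
    rw [← List.prod_ofFn]
    change _ = (Algebra.adjoin ℂ (Set.range T)).val (List.prod _)
    rw [map_list_prod, List.map_ofFn]
    rfl
  rw [h, h, prod_pow_add_single]
  rfl

theorem monom_add_single (z : EuclideanSpace ℂ (Fin d)) (i : Fin d) (α : Fin d → ℕ) :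
    monom z (α + Pi.single i 1) = z i * monom z α :=
  prod_pow_add_single _ i α

variable [CompleteSpace H] {T : Fin d → H →L[ℂ] H} {hT : IsOneOverContraction k T}

theorem coord_isometryV (hp : IsPure hT) (h : H) (α : Fin d → ℕ) :
    (isometryV hp h).coord α = (√(k.aMulti α) : ℂ) • defectMap hT (adjoint (tuplePow T α) h) := rfl

/-- `V_T T_i^*` is `V_T` followed by the backward weighted shift. -/
theorem sqrt_smul_coord_isometryV_adjoint (hp : IsPure hT) (i : Fin d) (h : H) (α : Fin d → ℕ) :
    (√(k.aMulti (α + Pi.single i 1)) : ℂ) • (isometryV hp (adjoint (T i) h)).coord α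
      = (√(k.aMulti α) : ℂ) • (isometryV hp h).coord (α + Pi.single i 1) := by
  rw [coord_isometryV, coord_isometryV, tuplePow_add_single hT.commute, adjoint_comp, smul_comm]
  rfl

/-- If `V_T` is surjective, then it intertwines `T_i` and the multiplication by `z_i`. -/
theorem isometryV_apply_of_surjective (hp : IsPure hT) (hs : Function.Surjective (isometryV hp))
    (i : Fin d) (h : H) (z : UnitBall d) :
    isometryV hp (T i h) z = z.1 i • isometryV hp h z := by
  have hne : ∀ α, (√(k.aMulti α) : ℂ) ≠ 0 := fun α => by
    exact_mod_cast (Real.sqrt_pos.mpr (k.aMulti_pos α)).ne'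
  -- By surjectivity every one-coordinate vector is some $V_Tg$. Testing against it moves $T_i$ to
  -- $T_i^*g$, where the backward shift formula applies.
  have hinner : ∀ β x g, isometryV hp g = Hk.single k β x →
      inner ℂ ((isometryV hp (T i h)).coord β) x
        = inner ℂ (isometryV hp h) (isometryV hp (adjoint (T i) g)) := by
    intro β x g hg
    rw [← Hk.inner_single, ← hg, LinearIsometry.inner_map_map, LinearIsometry.inner_map_map,
      adjoint_inner_right]
  -- The backward shift annihilates the monomials not divisible by $z_i$.
  have hzero : ∀ β, β i = 0 → (isometryV hp (T i h)).coord β = 0 := by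
    intro β hβ
    refine ext_inner_right ℂ fun x => ?_
    obtain ⟨g, hg⟩ := hs (Hk.single k β x)
    have h0 : isometryV hp (adjoint (T i) g) = 0 := Hk.ext_coord fun α => by
      have h1 := sqrt_smul_coord_isometryV_adjoint hp i g α
      rw [hg, Hk.coord_single, Pi.single_eq_of_ne (by rintro rfl; simp at hβ), smul_zero] at h1
      exact (smul_eq_zero.mp h1).resolve_left (hne _)
    rw [hinner β x g hg, h0, inner_zero_right, inner_zero_left]
  -- The backward shift sends the coordinate vector at $\alpha + e_i$ to a weighted one at $\alpha$.
  have hsucc : ∀ α, (√(k.aMulti (α + Pi.single i 1)) : ℂ) •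
      (isometryV hp (T i h)).coord (α + Pi.single i 1)
        = (√(k.aMulti α) : ℂ) • (isometryV hp h).coord α := by
    intro α
    refine ext_inner_right ℂ fun x => ?_
    obtain ⟨g, hg⟩ := hs (Hk.single k (α + Pi.single i 1) x)
    have h0 : (√(k.aMulti (α + Pi.single i 1)) : ℂ) • isometryV hp (adjoint (T i) g)
        = (√(k.aMulti α) : ℂ) • Hk.single k α x := Hk.ext_coord fun β => by
      rw [Hk.coord_smul, Hk.coord_smul, Hk.coord_single]
      by_cases hβ : β = α
      · subst hβ
        rw [sqrt_smul_coord_isometryV_adjoint, hg, Hk.coord_single, Pi.single_eq_same,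
          Pi.single_eq_same]
      · have h1 := sqrt_smul_coord_isometryV_adjoint hp i g β
        rw [hg, Hk.coord_single, Pi.single_eq_of_ne (by simpa using hβ), smul_zero] at h1
        rw [(smul_eq_zero.mp h1).resolve_left (hne _), Pi.single_eq_of_ne hβ, smul_zero, smul_zero]
    rw [inner_smul_left, hinner _ x g hg, Complex.conj_ofReal, ← inner_smul_right, h0,
      inner_smul_right, Hk.inner_single, inner_smul_left, Complex.conj_ofReal]
  -- Only indices $\beta = \alpha + e_i$ contribute, so the series of $V_TT_ih$ is reindexed by
  -- $\alpha$.
  have hinj : Function.Injective fun α : Fin d → ℕ => α + Pi.single i 1 := add_left_injective _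
  have h1 := Hk.hasSum_apply (isometryV hp (T i h)) z
  rw [← hinj.hasSum_iff] at h1
  · refine h1.unique (((Hk.hasSum_apply (isometryV hp h) z).const_smul (z.1 i)).congr_fun ?_)
    intro α
    rw [Function.comp_apply, monom_add_single, mul_comm, mul_smul, hsucc, smul_smul, smul_smul]
    congr 1
    ring
  · intro β hβ
    rw [hzero β, smul_zero]
    by_contra hi
    refine hβ ⟨β - Pi.single i 1, funext fun j => ?_⟩
    by_cases hj : j = i
    · subst hj
      simp only [Pi.add_apply, Pi.sub_apply, Pi.single_eq_same]
      omega
    · simp [Pi.single_eq_of_ne hj]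

theorem isUnitarilyEquivalentToShift_of_surjective (hp : IsPure hT)
    (hs : Function.Surjective (isometryV hp)) :
    IsUnitarilyEquivalentToShift k T (defectSpace hT) :=
  ⟨LinearIsometryEquiv.ofSurjective (isometryV hp) hs, isometryV_apply_of_surjective hp hs⟩

end Shift

end CNPFactor

/-! ### Comparison of the two multipliers -/

theorem mainTheorem5 {d : ℕ} (hd : 1 ≤ d)
    -- an admissible kernel with two factorizations `k = s₁ g₁ = s₂ g₂`
    (k s₁ s₂ : UIKernel d) (hk : IsAdmissible k) (hs₁ : IsCNP s₁) (hs₂ : IsCNP s₂)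
    (g₁ g₂ : UnitBall d → UnitBall d → ℂ)
    (hg₁ : (Matrix.of g₁).PosSemidef) (hg₂ : (Matrix.of g₂).PosSemidef)
    (hkg₁ : ∀ z w, k.ker z w = s₁.ker z w * g₁ z w)
    (hkg₂ : ∀ z w, k.ker z w = s₂.ker z w * g₂ z w)
    -- a non-trivial pure `1/k`-contraction
    {H : Type u} [NormedAddCommGroup H] [InnerProductSpace ℂ H] [CompleteSpace H]
    (T : Fin d → H →L[ℂ] H) (hT : IsOneOverContraction k T) (hp : IsPure hT)
    (hnt : ∀ (E : Type u) [NormedAddCommGroup E] [InnerProductSpace ℂ E] [CompleteSpace E],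
      ¬ IsUnitarilyEquivalentToShift k T E)
    -- two partially isometric multipliers
    {E₁ : Type v} [NormedAddCommGroup E₁] [InnerProductSpace ℂ E₁] [CompleteSpace E₁]
    {E₂ : Type w} [NormedAddCommGroup E₂] [InnerProductSpace ℂ E₂] [CompleteSpace E₂]
    (θ₁ : UnitBall d → E₁ →L[ℂ] defectSpace hT) (θ₂ : UnitBall d → E₂ →L[ℂ] defectSpace hT)
    (hθ₁ : IsMultiplier s₁ k θ₁) (hθ₂ : IsMultiplier s₂ k θ₂)
    (hpi₁ : IsPartialIsometry (mulOp hθ₁)) (hpi₂ : IsPartialIsometry (mulOp hθ₂))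
    (hV₁ : 1 - (isometryV hp).toContinuousLinearMap ∘L
        ContinuousLinearMap.adjoint (isometryV hp).toContinuousLinearMap
      = mulOp hθ₁ ∘L ContinuousLinearMap.adjoint (mulOp hθ₁))
    (hV₂ : 1 - (isometryV hp).toContinuousLinearMap ∘L
        ContinuousLinearMap.adjoint (isometryV hp).toContinuousLinearMap
      = mulOp hθ₂ ∘L ContinuousLinearMap.adjoint (mulOp hθ₂)) :
    (∃ Vm : Hk s₁ E₁ →L[ℂ] Hk s₂ E₂, IsPartialIsometry Vm ∧
      mulOp hθ₁ = mulOp hθ₂ ∘L Vm ∧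
      mulOp hθ₂ = mulOp hθ₁ ∘L ContinuousLinearMap.adjoint Vm) ∧
    ((∃ Vf : E₁ →L[ℂ] E₂, IsPartialIsometry Vf ∧
      ∀ z : UnitBall d, θ₁ z = θ₂ z ∘L Vf ∧ θ₂ z = θ₁ z ∘L ContinuousLinearMap.adjoint Vf) ↔
      s₁.ker = s₂.ker) := by
  have hPP : ∀ x, mulOp hθ₁ (ContinuousLinearMap.adjoint (mulOp hθ₁) x)
      = mulOp hθ₂ (ContinuousLinearMap.adjoint (mulOp hθ₂) x) := fun x =>
    congrArg (fun A : Hk k (defectSpace hT) →L[ℂ] Hk k (defectSpace hT) => A x)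
      (hV₁.symm.trans hV₂)
  have h₁ := comp_adjoint_comp_of_one_sub (isometryV hp) hV₁
  have h₂ := comp_adjoint_comp_of_one_sub (isometryV hp) hV₂
  -- The common projection, applied to the kernel function of $H_k \otimes
  -- \overline{\mathrm{Ran}}\,\Delta_T$ at $w$ in direction $x$.
  have hker : ∀ z w x, s₁.ker z w • θ₁ z (ContinuousLinearMap.adjoint (θ₁ w) x)
      = s₂.ker z w • θ₂ z (ContinuousLinearMap.adjoint (θ₂ w) x) := fun z w x => by
    rw [← mulOp_adjoint_mulOp_kerFun hθ₁, ← mulOp_adjoint_mulOp_kerFun hθ₂, hPP]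
  refine ⟨⟨ContinuousLinearMap.adjoint (mulOp hθ₂) ∘L mulOp hθ₁,
    IsPartialIsometry.of_apply_adjoint_apply fun x => ?_, ?_, ?_⟩, ?_, fun hs => ?_⟩
  · simp [ContinuousLinearMap.adjoint_comp, ← hPP, h₁]
  · ext x : 1
    simp [← hPP, h₁]
  · ext x : 1
    simp [ContinuousLinearMap.adjoint_comp, hPP, h₂]
  · rintro ⟨Vf, -, hVf⟩
    by_contra hs
    have hθθ : ∀ z w x, θ₂ z (ContinuousLinearMap.adjoint (θ₂ w) x)
        = θ₁ z (ContinuousLinearMap.adjoint (θ₁ w) x) := fun z w x => by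
      rw [(hVf z).2, (hVf w).1, ContinuousLinearMap.adjoint_comp]
      rfl
    have h0 : mulOp hθ₁ = 0 := mulOp_eq_zero_of_ker_ne hd hs hθ₁ fun z w x => by
      rw [hker, hθθ]
    -- With $M_{\theta_1} = 0$ the projection $I - V_TV_T^*$ is zero, so $V_T^*y$ is a preimage of
    -- $y$.
    refine hnt (defectSpace hT) (isUnitarilyEquivalentToShift_of_surjective hp fun y =>
      ⟨ContinuousLinearMap.adjoint (isometryV hp).toContinuousLinearMap y, ?_⟩)
    rw [h0, ContinuousLinearMap.zero_comp, sub_eq_zero] at hV₁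
    exact (congrArg (fun A : Hk k (defectSpace hT) →L[ℂ] Hk k (defectSpace hT) => A y) hV₁).symm
  -- The Gram entries are $\langle\theta_i(z)^*x, \theta_i(w)^*y\rangle = \langle x,
  -- \theta_i(z)\theta_i(w)^*y\rangle$; they agree once the common nonzero factor $s_2(z,w)$ is
  -- cancelled from `hker`.
  · obtain ⟨V, hV, ha, hb⟩ := exists_isPartialIsometry_of_inner_eq
      (a := fun p : UnitBall d × defectSpace hT => ContinuousLinearMap.adjoint (θ₁ p.1) p.2)
      (b := fun p : UnitBall d × defectSpace hT => ContinuousLinearMap.adjoint (θ₂ p.1) p.2)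
      fun p q => by
        rw [ContinuousLinearMap.adjoint_inner_left, ContinuousLinearMap.adjoint_inner_left]
        congr 1
        have := hker p.1 q.1 q.2
        rw [hs] at this
        exact smul_right_injective _ (s₂.nonvanishing p.1 q.1) this
    refine ⟨V, hV, fun z => ⟨?_, ?_⟩⟩
    · ext e : 1
      refine ext_inner_left ℂ fun x => ?_
      -- Here $\theta_1(z)^*x = V^*\theta_2(z)^*x$ is the adjoint form of $\theta_1(z) =
      -- \theta_2(z)V$.
      rw [← ContinuousLinearMap.adjoint_inner_left, ← hb (z, x),
        ContinuousLinearMap.adjoint_inner_left, ContinuousLinearMap.adjoint_inner_left]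
      rfl
    · ext e : 1
      refine ext_inner_left ℂ fun x => ?_
      rw [← ContinuousLinearMap.adjoint_inner_left, ← ha (z, x),
        ← ContinuousLinearMap.adjoint_inner_right, ContinuousLinearMap.adjoint_inner_left]
      rfl
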